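/- Let $\mathbb{F}$ be an algebraically closed field of characteristic not equal to $2$, let $V$ be a vector space over $\mathbb{F}$ of countably infinite dimension with a nondegenerate quadratic form $f$, and let $C\ell(V,f)$ be its Clifford algebra, that is, the unital associative algebra generated by $V$ with relations $v^2=f(v)\cdot 1$; it is graded by $\mathbb{Z}/2\mathbb{Z}$, with even part $C\ell(V,f)_{\bar 0}$ spanned by the products of an even number of vectors and odd part $C\ell(V,f)_{\bar 1}$ spanned by the products of an odd number of vectors. Let $(v_i)_{i\in\mathbb{N}}$ be an arbitrary orthonormal basis of $V$, so that $v_iv_j+v_jv_i=2\delta_{ij}$ in $C\ell(V,f)$. For a finite set $S=\{i_1<\dots<i_r\}\subset\mathbb{N}$ put $v_S=v_{i_1}\cdots v_{i_r}$ and $\mathrm{ad}(v_S)(x)=v_Sx-xv_S$. A derivation $D$ of $C\ell(V,f)$ is an $\mathbb{F}$-linear map with $D(ab)=D(a)b+aD(b)$; it is called even if it maps each of $C\ell(V,f)_{\bar 0}$, $C\ell(V,f)_{\bar 1}$ into itself, and odd if it maps each of them into the other. An equality $D=\sum_S\alpha_S\,\mathrm{ad}(v_S)$, with possibly infinitely many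 terms, means that for every $x\in C\ell(V,f)$ all but finitely many of the elements $\alpha_S\,\mathrm{ad}(v_S)(x)$ are zero and $D(x)$ is the sum of the others. (1) Every nonzero even derivation $D$ of $C\ell(V,f)$ can be uniquely represented as a sum $$D=\sum_S\alpha_S\,\mathrm{ad}(v_S),\qquad 0\neq\alpha_S\in\mathbb{F},$$ over a family of finite nonempty subsets $S\subset\mathbb{N}$ of even order such that every $i\in\mathbb{N}$ lies in no more than finitely many of the sets $S$ of the family. (2) Every nonzero odd derivation $D$ of $C\ell(V,f)$ can be uniquely represented as a sum $$D=\sum_S\alpha_S\,\mathrm{ad}(v_S),\qquad 0\neq\alpha_S\in\mathbb{F},$$ over a family of finite subsets $S\subset\mathbb{N}$ of odd order such that every $i\in\mathbb{N}$ lies in all but finitely many of the sets $S$ of the family. -/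

import Mathlib

namespace CliffordDer

/-- `v` is an orthonormal basis for the quadratic form `Q`: `Q (v i) = 1`, and `v i`, `v j` are
orthogonal for the polar form when `i ≠ j`, so that `v i * v j + v j * v i = 2 δ_ij` in the
Clifford algebra. -/
def IsOrthonormalBasis {F V : Type*} [Field F] [AddCommGroup V] [Module F V]
    (Q : QuadraticForm F V) (v : Module.Basis ℕ F V) : Prop :=
  (∀ i, Q (v i) = 1) ∧ ∀ i j, i ≠ j → Q.IsOrtho (v i) (v j)

/-- The ordered product `v_S = v_{i_1} ⋯ v_{i_r}` for `S = {i_1 < ⋯ < i_r}`, with value `1`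
for the empty set. -/
noncomputable def basisProd {F V : Type*} [Field F] [AddCommGroup V] [Module F V]
    (Q : QuadraticForm F V) (v : Module.Basis ℕ F V) (S : Finset ℕ) : CliffordAlgebra Q :=
  ((S.sort (· ≤ ·)).map fun i => CliffordAlgebra.ι Q (v i)).prod

/-- A linear derivation of a (not necessarily commutative) associative algebra. -/
def IsDerivation {F A : Type*} [Field F] [Ring A] [Algebra F A] (D : A →ₗ[F] A) : Prop :=
  ∀ a b, D (a * b) = D a * b + a * D b

/-- The inner derivation `ad a : x ↦ a * x - x * a`. -/
def ad (F : Type*) {A : Type*} [Field F] [Ring A] [Algebra F A] (a : A) : A →ₗ[F] A :=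
  LinearMap.mulLeft F a - LinearMap.mulRight F a

/-- A linear map of the Clifford algebra preserving the even and the odd part. -/
def IsEvenMap {F V : Type*} [Field F] [AddCommGroup V] [Module F V] (Q : QuadraticForm F V)
    (D : CliffordAlgebra Q →ₗ[F] CliffordAlgebra Q) : Prop :=
  (∀ x ∈ CliffordAlgebra.evenOdd Q 0, D x ∈ CliffordAlgebra.evenOdd Q 0) ∧
    ∀ x ∈ CliffordAlgebra.evenOdd Q 1, D x ∈ CliffordAlgebra.evenOdd Q 1

/-- A linear map of the Clifford algebra exchanging the even and the odd part. -/
def IsOddMap {F V : Type*} [Field F] [AddCommGroup V] [Module F V] (Q : QuadraticForm F V)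
    (D : CliffordAlgebra Q →ₗ[F] CliffordAlgebra Q) : Prop :=
  (∀ x ∈ CliffordAlgebra.evenOdd Q 0, D x ∈ CliffordAlgebra.evenOdd Q 1) ∧
    ∀ x ∈ CliffordAlgebra.evenOdd Q 1, D x ∈ CliffordAlgebra.evenOdd Q 0

/-- `D` is the sum of the (possibly infinite) family `T` of linear maps in the topology of
pointwise convergence, the algebra being discrete: at every element all but finitely many
terms vanish, and `D` is the sum of the remaining ones. -/
def IsPointwiseSum {ι F A : Type*} [Field F] [Ring A] [Algebra F A]
    (T : ι → A →ₗ[F] A) (D : A →ₗ[F] A) : Prop :=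
  ∀ x, {i | T i x ≠ 0}.Finite ∧ D x = ∑ᶠ i, T i x

end CliffordDer

/-!
The ordered products `v_S` form a basis of the Clifford algebra. They span it because left
multiplication by a basis vector sends `v_S` to `± v_{S ∆ {i}}`; they are independent because the
operators given by the same formula on the free module on the finite subsets of `ℕ` satisfy the
Clifford relations, and the resulting action sends the generator `∅` to the generator `S` under
`v_S`.

Each `v_S` either commutes or anticommutes with `v i`; it anticommutes exactly when
`|S| - [i ∈ S]` is odd, that is, for `|S|` even when `i ∈ S`, for `|S|` odd when `i ∉ S`. Let `D`
be a derivation and let `c i S` be the coefficient of `v_S` in `D (v i) * v i`. Differentiating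
`v i ^ 2 = 1` shows that `c i S = 0` unless `v_S` anticommutes with `v i`, and differentiating
`v i * v j + v j * v i = 0` shows that `c i S = c j S` whenever `v_S` anticommutes with both
(`derivCoeff_eq_zero`, `derivCoeff_eq`). Since `ad v_S` sends `v i` to `2 v_S v i` or to `0`, the
sum of the `α_S ad v_S` with `α_S = c i S / 2`, for any `i` such that `v_S` and `v i` anticommute,
agrees with `D` on every `v i`, and only finitely many terms are nonzero there. Both properties
pass to products, so the sum converges to `D` pointwise (`isPointwiseSum_adCoeff`).

Conversely a convergent sum `∑ α_S ad v_S = D` forces `c i S = 2 α_S` for such `i`, which gives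
uniqueness. The parity of `D` restricts the parity of `|S|`, and the support of `D (v i) * v i`
being finite is the required finiteness condition on the family.
-/

open scoped symmDiff

namespace CliffordDer

/-! ### The basis of ordered products -/

section Monomials

variable {F V : Type*} [Field F] [AddCommGroup V] [Module F V]
  {Q : QuadraticForm F V} {v : Module.Basis ℕ F V}

/-- The sign `(-1) ^ #{j ∈ S | j < i}` picked up when `v i` is moved to its place in `v_S`. -/
def insertSign (F : Type*) [Field F] (i : ℕ) (S : Finset ℕ) : F :=
  (-1) ^ (S.filter (· < i)).card

/-- The sign `(-1) ^ #(S \ {i})`, which satisfies `v_S * v i = commSign i S • (v i * v_S)`. -/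
def commSign (F : Type*) [Field F] (i : ℕ) (S : Finset ℕ) : F :=
  (-1) ^ (S.erase i).card

lemma IsOrthonormalBasis.ι_mul_self (hv : IsOrthonormalBasis Q v) (i : ℕ) :
    CliffordAlgebra.ι Q (v i) * CliffordAlgebra.ι Q (v i) = 1 := by
  rw [CliffordAlgebra.ι_sq_scalar, hv.1, map_one]

lemma IsOrthonormalBasis.ι_mul_ι_comm (hv : IsOrthonormalBasis Q v) {i j : ℕ} (h : i ≠ j) :
    CliffordAlgebra.ι Q (v i) * CliffordAlgebra.ι Q (v j) =
      -(CliffordAlgebra.ι Q (v j) * CliffordAlgebra.ι Q (v i)) :=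
  CliffordAlgebra.ι_mul_ι_comm_of_isOrtho (hv.2 i j h)

lemma basisProd_empty : basisProd Q v ∅ = 1 := by simp [basisProd]

lemma basisProd_insert {a : ℕ} {S : Finset ℕ} (h : ∀ x ∈ S, a < x) :
    basisProd Q v (insert a S) = CliffordAlgebra.ι Q (v a) * basisProd Q v S := by
  rw [basisProd, Finset.sort_insert _ (fun b hb => (h b hb).le) fun ha => (h a ha).false]
  simp [basisProd]

lemma basisProd_singleton (i : ℕ) : basisProd Q v {i} = CliffordAlgebra.ι Q (v i) := by
  simp [basisProd]

/-- Left multiplication by a basis vector permutes the ordered products up to sign. -/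
lemma ι_mul_basisProd (hv : IsOrthonormalBasis Q v) (i : ℕ) (S : Finset ℕ) :
    CliffordAlgebra.ι Q (v i) * basisProd Q v S =
      insertSign F i S • basisProd Q v (S ∆ {i}) := by
  induction S using Finset.induction_on_min with
  | empty =>
    have h1 : (∅ : Finset ℕ) ∆ {i} = {i} := bot_symmDiff _
    rw [basisProd_empty, mul_one, h1, basisProd_singleton]
    simp [insertSign]
  | insert a S ha ih =>
    have haS : a ∉ S := fun h => (ha a h).false
    rcases lt_trichotomy i a with hia | rfl | hai
    · have hmin : ∀ x ∈ insert a S, i < x := by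
        simp only [Finset.mem_insert, forall_eq_or_imp]
        exact ⟨hia, fun x hx => hia.trans (ha x hx)⟩
      have h1 : (insert a S) ∆ {i} = insert i (insert a S) := by
        ext x
        have := fun h => (hmin x h).ne'
        simp only [Finset.mem_symmDiff, Finset.mem_singleton]
        grind
      have h2 : insertSign F i (insert a S) = 1 := by
        rw [insertSign, Finset.filter_false_of_mem fun x hx => (hmin x hx).not_gt]
        simp
      rw [h1, h2, basisProd_insert hmin, one_smul]
    · have h1 : (insert i S) ∆ {i} = S := by
        ext x
        simp only [Finset.mem_symmDiff, Finset.mem_singleton]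
        grind
      have h2 : insertSign F i (insert i S) = 1 := by
        rw [insertSign, Finset.filter_false_of_mem]
        · simp
        · simp only [Finset.mem_insert, forall_eq_or_imp, lt_irrefl, not_false_eq_true, true_and]
          exact fun x hx => (ha x hx).not_gt
      rw [h1, h2, basisProd_insert ha, ← mul_assoc, hv.ι_mul_self, one_mul, one_smul]
    · have h1 : (insert a S) ∆ {i} = insert a (S ∆ {i}) := by
        ext x
        simp only [Finset.mem_symmDiff, Finset.mem_singleton, Finset.mem_insert]
        grind
      have h2 : insertSign F i (insert a S) = -insertSign F i S := by
        rw [insertSign, insertSign, Finset.filter_insert, if_pos hai,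
          Finset.card_insert_of_notMem (by simp [haS]), pow_succ, mul_neg_one]
      have h3 : ∀ x ∈ S ∆ {i}, a < x := by
        intro x hx
        simp only [Finset.mem_symmDiff, Finset.mem_singleton] at hx
        grind
      rw [h1, h2, basisProd_insert ha, basisProd_insert h3, ← mul_assoc,
        hv.ι_mul_ι_comm hai.ne', neg_mul, mul_assoc, ih, mul_smul_comm, neg_smul]

lemma basisProd_mul_ι (hv : IsOrthonormalBasis Q v) (i : ℕ) (S : Finset ℕ) :
    basisProd Q v S * CliffordAlgebra.ι Q (v i) =
      commSign F i S • (CliffordAlgebra.ι Q (v i) * basisProd Q v S) := by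
  induction S using Finset.induction_on_min with
  | empty => simp [basisProd_empty, commSign]
  | insert a S ha ih =>
    have haS : a ∉ S := fun h => (ha a h).false
    rw [basisProd_insert ha, mul_assoc, ih, mul_smul_comm]
    by_cases hia : i = a
    · subst hia
      simp [commSign, haS]
    · rw [commSign, commSign, Finset.erase_insert_of_ne (Ne.symm hia),
        Finset.card_insert_of_notMem (by simp [haS]), pow_succ, mul_neg_one, neg_smul,
        ← mul_assoc, ← mul_assoc, hv.ι_mul_ι_comm hia, neg_mul, smul_neg, neg_neg]

/-- The action of `v i` on the free module on the finite subsets of `ℕ` that models left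
multiplication on the ordered products. -/
noncomputable def leftAction (F : Type*) [Field F] (i : ℕ) :
    Module.End F (Finset ℕ →₀ F) :=
  Finsupp.linearCombination F fun S => Finsupp.single (S ∆ {i}) (insertSign F i S)

lemma leftAction_single (i : ℕ) (S : Finset ℕ) (c : F) :
    leftAction F i (Finsupp.single S c) = Finsupp.single (S ∆ {i}) (c * insertSign F i S) := by
  simp [leftAction]

lemma leftAction_mul_self (i : ℕ) : leftAction F i * leftAction F i = 1 := by
  refine Finsupp.lhom_ext fun S c => ?_
  have h : (S ∆ {i}).filter (· < i) = S.filter (· < i) := by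
    ext x
    simp only [Finset.mem_filter, Finset.mem_symmDiff, Finset.mem_singleton]
    grind
  rw [Module.End.mul_apply, leftAction_single, leftAction_single, symmDiff_symmDiff_cancel_right,
    insertSign, insertSign, h, mul_assoc, ← mul_pow]
  simp

lemma leftAction_add_swap_of_lt {i j : ℕ} (hij : i < j) :
    leftAction F i * leftAction F j + leftAction F j * leftAction F i = 0 := by
  refine Finsupp.lhom_ext fun S c => ?_
  have h1 : insertSign F i (S ∆ {j}) = insertSign F i S := by
    have : (S ∆ {j}).filter (· < i) = S.filter (· < i) := by
      ext x
      simp only [Finset.mem_filter, Finset.mem_symmDiff, Finset.mem_singleton]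
      grind
    rw [insertSign, insertSign, this]
  have h2 : insertSign F j (S ∆ {i}) = -insertSign F j S := by
    rw [insertSign, insertSign]
    by_cases hi : i ∈ S
    · have : S.filter (· < j) = insert i ((S ∆ {i}).filter (· < j)) := by
        ext x
        simp only [Finset.mem_filter, Finset.mem_symmDiff, Finset.mem_singleton, Finset.mem_insert]
        grind
      rw [this, Finset.card_insert_of_notMem (by simp [Finset.mem_symmDiff, hi]), pow_succ]
      ring
    · have : (S ∆ {i}).filter (· < j) = insert i (S.filter (· < j)) := by
        ext x
        simp only [Finset.mem_filter, Finset.mem_symmDiff, Finset.mem_singleton, Finset.mem_insert]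
        grind
      rw [this, Finset.card_insert_of_notMem (by simp [hi]), pow_succ]
      ring
  rw [LinearMap.add_apply, Module.End.mul_apply, Module.End.mul_apply, leftAction_single,
    leftAction_single, leftAction_single, leftAction_single, h1, h2,
    symmDiff_right_comm, ← Finsupp.single_add, LinearMap.zero_apply, Finsupp.single_eq_zero]
  ring

lemma leftAction_add_swap {i j : ℕ} (hij : i ≠ j) :
    leftAction F i * leftAction F j + leftAction F j * leftAction F i = 0 := by
  rcases hij.lt_or_gt with h | h
  · exact leftAction_add_swap_of_lt h
  · rw [add_comm, leftAction_add_swap_of_lt h]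

/-- The operators `leftAction F i` satisfy the relations of the orthonormal basis vectors; since
`2` is invertible, it suffices to check the polarized relations on pairs of basis vectors. -/
lemma constr_leftAction_mul_self (h2 : (2 : F) ≠ 0) (hv : IsOrthonormalBasis Q v) (x : V) :
    v.constr F (leftAction F) x * v.constr F (leftAction F) x =
      algebraMap F (Module.End F (Finset ℕ →₀ F)) (Q x) := by
  have hu : IsUnit (2 : Module.End F (Finset ℕ →₀ F)) := by
    have := (IsUnit.mk0 _ h2).map (algebraMap F (Module.End F (Finset ℕ →₀ F)))
    rwa [map_ofNat] at this
  refine (CliffordAlgebra.forall_mul_self_eq_iff hu _).2 ?_ x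
  refine v.ext fun i => v.ext fun j => ?_
  change v.constr F (leftAction F) (v i) * v.constr F (leftAction F) (v j) +
      v.constr F (leftAction F) (v j) * v.constr F (leftAction F) (v i) =
    algebraMap F _ (QuadraticMap.polar Q (v i) (v j))
  rw [Module.Basis.constr_basis, Module.Basis.constr_basis]
  by_cases hij : i = j
  · subst hij
    rw [QuadraticMap.polar_self, hv.1, leftAction_mul_self, two_smul, map_add, map_one]
  · rw [(hv.2 i j hij).polar_eq_zero, map_zero, leftAction_add_swap hij]

/-- The coordinates of an element of the Clifford algebra with respect to the ordered products:
let the element act on the basis vector `∅` of the free module on the finite subsets of `ℕ`. -/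
noncomputable def coordMap (h2 : (2 : F) ≠ 0) (hv : IsOrthonormalBasis Q v) :
    CliffordAlgebra Q →ₗ[F] (Finset ℕ →₀ F) :=
  (LinearMap.applyₗ (Finsupp.single ∅ 1)).comp
    (CliffordAlgebra.lift Q
      ⟨v.constr F (leftAction F), constr_leftAction_mul_self h2 hv⟩).toLinearMap

lemma coordMap_one (h2 : (2 : F) ≠ 0) (hv : IsOrthonormalBasis Q v) :
    coordMap h2 hv 1 = Finsupp.single ∅ 1 := by
  simp [coordMap]

lemma coordMap_ι_mul (h2 : (2 : F) ≠ 0) (hv : IsOrthonormalBasis Q v) (y : V)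
    (x : CliffordAlgebra Q) :
    coordMap h2 hv (CliffordAlgebra.ι Q y * x) =
      v.constr F (leftAction F) y (coordMap h2 hv x) := by
  simp [coordMap]

lemma coordMap_basisProd (h2 : (2 : F) ≠ 0) (hv : IsOrthonormalBasis Q v) (S : Finset ℕ) :
    coordMap h2 hv (basisProd Q v S) = Finsupp.single S 1 := by
  induction S using Finset.induction_on_min with
  | empty => rw [basisProd_empty, coordMap_one]
  | insert a S ha ih =>
    have h1 : S ∆ {a} = insert a S := by
      ext x
      have := fun h => (ha x h).ne'
      simp only [Finset.mem_symmDiff, Finset.mem_singleton]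
      grind
    rw [basisProd_insert ha, coordMap_ι_mul, ih, Module.Basis.constr_basis, leftAction_single, h1,
      insertSign, Finset.filter_false_of_mem fun x hx => (ha x hx).not_gt]
    simp

lemma linearCombination_constr_leftAction (hv : IsOrthonormalBasis Q v) (y : V)
    (f : Finset ℕ →₀ F) :
    Finsupp.linearCombination F (basisProd Q v) (v.constr F (leftAction F) y f) =
      CliffordAlgebra.ι Q y * Finsupp.linearCombination F (basisProd Q v) f := by
  have hy : y ∈ Submodule.span F (Set.range v) := v.mem_span y
  induction hy using Submodule.span_induction with
  | zero => simp
  | add x y _ _ hx hy => simp only [map_add, LinearMap.add_apply, hx, hy, add_mul]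
  | smul c x _ hx => simp only [map_smul, LinearMap.smul_apply, hx, smul_mul_assoc]
  | mem y hy =>
    obtain ⟨i, rfl⟩ := hy
    rw [Module.Basis.constr_basis]
    induction f using Finsupp.induction_linear with
    | zero => simp
    | add f g hf hg => simp only [map_add, hf, hg, mul_add]
    | single S c =>
      rw [leftAction_single, Finsupp.linearCombination_single, Finsupp.linearCombination_single,
        mul_smul_comm, ι_mul_basisProd hv, smul_smul]

lemma linearCombination_coordMap (h2 : (2 : F) ≠ 0) (hv : IsOrthonormalBasis Q v)
    (x : CliffordAlgebra Q) :
    Finsupp.linearCombination F (basisProd Q v) (coordMap h2 hv x) = x := by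
  induction x using CliffordAlgebra.left_induction with
  | algebraMap r =>
    rw [Algebra.algebraMap_eq_smul_one, map_smul, coordMap_one, map_smul,
      Finsupp.linearCombination_single, one_smul, basisProd_empty]
  | add x y hx hy => rw [map_add, map_add, hx, hy]
  | ι_mul x m hx => rw [coordMap_ι_mul, linearCombination_constr_leftAction hv, hx]

/-- The ordered products `v_S` form a basis of the Clifford algebra. -/
noncomputable def monomialBasis (h2 : (2 : F) ≠ 0) (hv : IsOrthonormalBasis Q v) :
    Module.Basis (Finset ℕ) F (CliffordAlgebra Q) :=
  .ofRepr <| LinearEquiv.ofLinearMap (coordMap h2 hv)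
    (Finsupp.linearCombination F (basisProd Q v))
    (Finsupp.lhom_ext fun S c => by
      rw [LinearMap.comp_apply, Finsupp.linearCombination_single, map_smul, coordMap_basisProd]
      simp)
    (LinearMap.ext (linearCombination_coordMap h2 hv))

@[simp]
lemma monomialBasis_apply (h2 : (2 : F) ≠ 0) (hv : IsOrthonormalBasis Q v) (S : Finset ℕ) :
    monomialBasis h2 hv S = basisProd Q v S := by
  rw [monomialBasis, Module.Basis.coe_ofRepr]
  simp

end Monomials

/-! ### Coefficients of a derivation on the basis vectors -/

section Derivations

variable {F V : Type*} [Field F] [AddCommGroup V] [Module F V]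
  {Q : QuadraticForm F V} {v : Module.Basis ℕ F V}

lemma commSign_mul_self (i : ℕ) (S : Finset ℕ) : commSign F i S * commSign F i S = 1 := by
  rw [commSign, ← mul_pow]
  simp

lemma commSign_eq_one_or (F : Type*) [Field F] (i : ℕ) (S : Finset ℕ) :
    commSign F i S = 1 ∨ commSign F i S = -1 :=
  neg_one_pow_eq_or F _

lemma commSign_eq_neg_one_iff (h2 : (2 : F) ≠ 0) (i : ℕ) (S : Finset ℕ) :
    commSign F i S = -1 ↔ (Even S.card ↔ i ∈ S) := by
  have hne : (1 : F) ≠ -1 := fun h => h2 (by linear_combination h)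
  have hodd : ∀ n : ℕ, (-1 : F) ^ n = -1 ↔ ¬ Even n := by
    intro n
    rcases n.even_or_odd with h | h
    · simp [h, hne]
    · simp [h.neg_one_pow, Nat.not_even_iff_odd.2 h]
  rw [commSign, hodd]
  by_cases hi : i ∈ S
  · rw [← Finset.card_erase_add_one hi, Nat.even_add_one]
    simp [hi]
  · rw [Finset.erase_eq_of_notMem hi]
    simp [hi]

lemma ι_mul_basisProd_mul_ι (hv : IsOrthonormalBasis Q v) (i : ℕ) (S : Finset ℕ) :
    CliffordAlgebra.ι Q (v i) * basisProd Q v S * CliffordAlgebra.ι Q (v i) =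
      commSign F i S • basisProd Q v S := by
  rw [mul_assoc, basisProd_mul_ι hv, mul_smul_comm, ← mul_assoc, hv.ι_mul_self, one_mul]

lemma ad_apply {A : Type*} [Ring A] [Algebra F A] (a x : A) : ad F a x = a * x - x * a := by
  simp [ad]

lemma ad_basisProd_ι (hv : IsOrthonormalBasis Q v) (i : ℕ) (S : Finset ℕ) :
    ad F (basisProd Q v S) (CliffordAlgebra.ι Q (v i)) =
      (1 - commSign F i S) • (basisProd Q v S * CliffordAlgebra.ι Q (v i)) := by
  rw [ad_apply, sub_smul, one_smul, basisProd_mul_ι hv, smul_smul, commSign_mul_self, one_smul]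

lemma repr_ι_mul_mul_ι (h2 : (2 : F) ≠ 0) (hv : IsOrthonormalBasis Q v) (i : ℕ) (S : Finset ℕ)
    (x : CliffordAlgebra Q) :
    (monomialBasis h2 hv).repr (CliffordAlgebra.ι Q (v i) * x * CliffordAlgebra.ι Q (v i)) S =
      commSign F i S * (monomialBasis h2 hv).repr x S := by
  have hx : x ∈ Submodule.span F (Set.range (monomialBasis h2 hv)) :=
    (monomialBasis h2 hv).mem_span x
  induction hx using Submodule.span_induction with
  | zero => simp
  | add x y _ _ hx hy => simp only [mul_add, add_mul, map_add, Finsupp.add_apply, hx, hy]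
  | smul c x _ hx =>
    simp only [mul_smul_comm, smul_mul_assoc, map_smul, Finsupp.smul_apply, hx, smul_eq_mul]
    ring
  | mem y hy =>
    obtain ⟨T, rfl⟩ := hy
    rw [monomialBasis_apply, ι_mul_basisProd_mul_ι hv, map_smul,
      ← monomialBasis_apply h2 hv, Module.Basis.repr_self, Finsupp.smul_apply, smul_eq_mul]
    by_cases h : T = S
    · rw [h]
    · simp [Finsupp.single_eq_of_ne' h]

lemma repr_involute (h2 : (2 : F) ≠ 0) (hv : IsOrthonormalBasis Q v) (S : Finset ℕ)
    (x : CliffordAlgebra Q) :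
    (monomialBasis h2 hv).repr (CliffordAlgebra.involute x) S =
      (-1) ^ S.card * (monomialBasis h2 hv).repr x S := by
  have hx : x ∈ Submodule.span F (Set.range (monomialBasis h2 hv)) :=
    (monomialBasis h2 hv).mem_span x
  induction hx using Submodule.span_induction with
  | zero => simp
  | add x y _ _ hx hy => simp only [mul_add, map_add, Finsupp.add_apply, hx, hy]
  | smul c x _ hx =>
    simp only [map_smul, Finsupp.smul_apply, hx, smul_eq_mul]
    ring
  | mem y hy =>
    obtain ⟨T, rfl⟩ := hy
    have h1 : CliffordAlgebra.involute (basisProd Q v T) = (-1 : F) ^ T.card • basisProd Q v T := by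
      have := CliffordAlgebra.involute_prod_map_ι (Q := Q) ((T.sort (· ≤ ·)).map v)
      rw [List.map_map, List.length_map, Finset.length_sort] at this
      exact this
    rw [monomialBasis_apply, h1, map_smul, ← monomialBasis_apply h2 hv, Module.Basis.repr_self,
      Finsupp.smul_apply, smul_eq_mul]
    by_cases h : T = S
    · rw [h]
    · simp [Finsupp.single_eq_of_ne' h]

lemma even_card_of_repr_ne_zero (h2 : (2 : F) ≠ 0) (hv : IsOrthonormalBasis Q v) {S : Finset ℕ}
    {x : CliffordAlgebra Q} (hx : x ∈ CliffordAlgebra.evenOdd Q 0)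
    (hS : (monomialBasis h2 hv).repr x S ≠ 0) : Even S.card := by
  have h := repr_involute h2 hv S x
  rw [CliffordAlgebra.involute_eq_of_mem_even hx] at h
  by_contra hodd
  rw [(Nat.not_even_iff_odd.1 hodd).neg_one_pow] at h
  exact mul_ne_zero h2 hS (by linear_combination h)

lemma odd_card_of_repr_ne_zero (h2 : (2 : F) ≠ 0) (hv : IsOrthonormalBasis Q v) {S : Finset ℕ}
    {x : CliffordAlgebra Q} (hx : x ∈ CliffordAlgebra.evenOdd Q 1)
    (hS : (monomialBasis h2 hv).repr x S ≠ 0) : Odd S.card := by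
  have h := repr_involute h2 hv S x
  rw [CliffordAlgebra.involute_eq_of_mem_odd hx, map_neg, Finsupp.neg_apply] at h
  by_contra heven
  rw [(Nat.not_odd_iff_even.1 heven).neg_one_pow] at h
  exact mul_ne_zero h2 hS (by linear_combination -h)

/-- The coefficient of `v_S` in `D (v i) * v i`. If `D = ∑ α_S ad v_S`, it equals `2 α_S` when
`v_S` and `v i` anticommute, and `0` when they commute. -/
noncomputable def derivCoeff (h2 : (2 : F) ≠ 0) (hv : IsOrthonormalBasis Q v)
    (D : CliffordAlgebra Q →ₗ[F] CliffordAlgebra Q) (i : ℕ) : Finset ℕ →₀ F :=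
  (monomialBasis h2 hv).repr (D (CliffordAlgebra.ι Q (v i)) * CliffordAlgebra.ι Q (v i))

variable {D : CliffordAlgebra Q →ₗ[F] CliffordAlgebra Q}

lemma IsDerivation.map_one (hD : IsDerivation D) : D 1 = 0 := by
  have h := hD 1 1
  simpa using h

/-- Apply `D` to `v i ^ 2 = 1`. -/
lemma derivCoeff_eq_zero (h2 : (2 : F) ≠ 0) (hv : IsOrthonormalBasis Q v) (hD : IsDerivation D)
    {i : ℕ} {S : Finset ℕ} (hS : commSign F i S ≠ -1) : derivCoeff h2 hv D i S = 0 := by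
  have h := hD (CliffordAlgebra.ι Q (v i)) (CliffordAlgebra.ι Q (v i))
  rw [hv.ι_mul_self, hD.map_one] at h
  have h' : CliffordAlgebra.ι Q (v i) *
      (D (CliffordAlgebra.ι Q (v i)) * CliffordAlgebra.ι Q (v i)) * CliffordAlgebra.ι Q (v i) =
      -(D (CliffordAlgebra.ι Q (v i)) * CliffordAlgebra.ι Q (v i)) := by
    rw [mul_assoc, mul_assoc, hv.ι_mul_self, mul_one]
    exact eq_neg_of_add_eq_zero_right h.symm
  have h3 := repr_ι_mul_mul_ι h2 hv i S
    (D (CliffordAlgebra.ι Q (v i)) * CliffordAlgebra.ι Q (v i))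
  rw [h', map_neg, Finsupp.neg_apply, (commSign_eq_one_or F i S).resolve_right hS] at h3
  refine (mul_eq_zero.1 (?_ : 2 * derivCoeff h2 hv D i S = 0)).resolve_left h2
  rw [derivCoeff]
  linear_combination -h3

/-- Apply `D` to `v i * v j + v j * v i = 0` and multiply by `v j * v i` on the right. -/
lemma derivCoeff_eq (h2 : (2 : F) ≠ 0) (hv : IsOrthonormalBasis Q v) (hD : IsDerivation D)
    {i j : ℕ} {S : Finset ℕ} (hi : commSign F i S = -1) (hj : commSign F j S = -1) :
    derivCoeff h2 hv D i S = derivCoeff h2 hv D j S := by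
  rcases eq_or_ne i j with rfl | hij
  · rfl
  have h : D (CliffordAlgebra.ι Q (v i) * CliffordAlgebra.ι Q (v j) +
      CliffordAlgebra.ι Q (v j) * CliffordAlgebra.ι Q (v i)) = 0 := by
    rw [hv.ι_mul_ι_comm hij, neg_add_cancel, map_zero]
  rw [map_add, hD, hD] at h
  have hki := repr_ι_mul_mul_ι h2 hv j S
    (D (CliffordAlgebra.ι Q (v i)) * CliffordAlgebra.ι Q (v i))
  have hkj := repr_ι_mul_mul_ι h2 hv i S
    (D (CliffordAlgebra.ι Q (v j)) * CliffordAlgebra.ι Q (v j))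
  have hii := hv.ι_mul_self i
  have hjj := hv.ι_mul_self j
  have hc := hv.ι_mul_ι_comm hij
  rw [hj] at hki
  rw [hi] at hkj
  rw [derivCoeff, derivCoeff]
  generalize CliffordAlgebra.ι Q (v i) = a at *
  generalize CliffordAlgebra.ι Q (v j) = b at *
  have key : D a * a - b * (D a * a) * b = D b * b - a * (D b * b) * a := by
    have e1 : D a * b * (b * a) = D a * a := by
      rw [mul_assoc, ← mul_assoc b, hjj, one_mul]
    have e2 : a * D b * (b * a) = a * (D b * b) * a := by simp only [mul_assoc]
    have e3 : D b * a * (b * a) = -(D b * b) := by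
      rw [mul_assoc, ← mul_assoc a, hc, neg_mul, mul_assoc, hii, mul_one, mul_neg]
    have e4 : b * D a * (b * a) = -(b * (D a * a) * b) := by
      rw [← neg_eq_iff_eq_neg.2 hc]
      simp only [mul_neg, mul_assoc]
    have h5 := congrArg (· * (b * a)) h
    simp only [add_mul, e1, e2, e3, e4, zero_mul] at h5
    rw [← sub_eq_zero, ← h5]
    abel
  have key' := congrArg (fun x => (monomialBasis h2 hv).repr x S) key
  simp only [map_sub, Finsupp.sub_apply, hki, hkj] at key'
  refine mul_left_cancel₀ h2 ?_
  linear_combination key'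

/-! ### Pointwise convergent sums of derivations -/

lemma isDerivation_ad {A : Type*} [Ring A] [Algebra F A] (a : A) : IsDerivation (ad F a) := by
  intro x y
  simp only [ad_apply]
  noncomm_ring

lemma IsDerivation.smul {A : Type*} [Ring A] [Algebra F A] {T : A →ₗ[F] A} (hT : IsDerivation T)
    (c : F) : IsDerivation (c • T) := by
  intro x y
  simp [hT x y]

/-- A family of derivations whose sum is the derivation `D` on the basis vectors sums to `D`
everywhere, because the elements at which this holds form a subalgebra. -/
lemma isPointwiseSum_of_basis {κ : Type*} (v : Module.Basis ℕ F V)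
    {T : κ → CliffordAlgebra Q →ₗ[F] CliffordAlgebra Q}
    (hT : ∀ k, IsDerivation (T k)) (hD : IsDerivation D)
    (h : ∀ i, {k | T k (CliffordAlgebra.ι Q (v i)) ≠ 0}.Finite ∧
      D (CliffordAlgebra.ι Q (v i)) = ∑ᶠ k, T k (CliffordAlgebra.ι Q (v i))) :
    IsPointwiseSum T D := by
  have hadd : ∀ x y, ({k | T k x ≠ 0}.Finite ∧ D x = ∑ᶠ k, T k x) →
      ({k | T k y ≠ 0}.Finite ∧ D y = ∑ᶠ k, T k y) →
      ({k | T k (x + y) ≠ 0}.Finite ∧ D (x + y) = ∑ᶠ k, T k (x + y)) := by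
    rintro x y ⟨hx, hx'⟩ ⟨hy, hy'⟩
    simp only [map_add]
    refine ⟨(hx.union hy).subset fun k hk => ?_, ?_⟩
    · by_contra hn
      simp only [Set.mem_union, Set.mem_ofPred_eq, not_or, not_not] at hn
      exact hk (by rw [hn.1, hn.2, add_zero])
    · rw [hx', hy', finsum_add_distrib hx hy]
  intro x
  induction x using CliffordAlgebra.induction with
  | algebraMap r =>
    have : ∀ {T : CliffordAlgebra Q →ₗ[F] CliffordAlgebra Q}, IsDerivation T →
        T (algebraMap F _ r) = 0 := fun hT => by
      rw [Algebra.algebraMap_eq_smul_one, map_smul, hT.map_one, smul_zero]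
    simp [this hD, fun k => this (hT k)]
  | ι y =>
    have hy : y ∈ Submodule.span F (Set.range v) := v.mem_span y
    induction hy using Submodule.span_induction with
    | mem y hy =>
      obtain ⟨i, rfl⟩ := hy
      exact h i
    | zero => simp
    | add x y _ _ hx hy =>
      rw [map_add]
      exact hadd _ _ hx hy
    | smul c x _ hx =>
      simp only [map_smul]
      refine ⟨hx.1.subset fun k hk hk0 => hk (by rw [hk0, smul_zero]), ?_⟩
      rw [hx.2, smul_finsum' _ hx.1]
  | add x y hx hy => exact hadd _ _ hx hy
  | mul x y hx hy =>
    have hl : {k | T k x * y ≠ 0}.Finite :=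
      hx.1.subset fun k hk hk0 => hk (by rw [hk0, zero_mul])
    have hr : {k | x * T k y ≠ 0}.Finite :=
      hy.1.subset fun k hk hk0 => hk (by rw [hk0, mul_zero])
    simp only [fun k => hT k x y, hD x y]
    refine ⟨(hl.union hr).subset fun k hk => ?_, ?_⟩
    · by_contra hn
      simp only [Set.mem_union, Set.mem_ofPred_eq, not_or, not_not] at hn
      exact hk (by rw [hn.1, hn.2, add_zero])
    · rw [hx.2, hy.2, finsum_add_distrib hl hr, finsum_mul' _ _ hx.1, mul_finsum' _ _ hy.1]

/-! ### Existence and uniqueness of the coefficients -/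

/-- The coefficients of a pointwise convergent sum of inner derivations can be read off from the
values of the sum at the basis vectors. -/
lemma derivCoeff_of_isPointwiseSum (h2 : (2 : F) ≠ 0) (hv : IsOrthonormalBasis Q v)
    {α : Finset ℕ → F} (h : IsPointwiseSum (fun S => α S • ad F (basisProd Q v S)) D)
    (i : ℕ) (S : Finset ℕ) :
    derivCoeff h2 hv D i S = α S * (1 - commSign F i S) := by
  obtain ⟨hfin, hsum⟩ := h (CliffordAlgebra.ι Q (v i))
  let φ : CliffordAlgebra Q →+ F :=
    ((Finsupp.lapply S ∘ₗ (monomialBasis h2 hv).repr.toLinearMap) ∘ₗ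
      LinearMap.mulRight F (CliffordAlgebra.ι Q (v i))).toAddMonoidHom
  have hφ : ∀ x, φ x = (monomialBasis h2 hv).repr (x * CliffordAlgebra.ι Q (v i)) S :=
    fun x => rfl
  have hterm : ∀ T, φ ((α T • ad F (basisProd Q v T)) (CliffordAlgebra.ι Q (v i))) =
      Finsupp.single T (α T * (1 - commSign F i T)) S := by
    intro T
    rw [hφ, LinearMap.smul_apply, ad_basisProd_ι hv, smul_smul, smul_mul_assoc, mul_assoc,
      hv.ι_mul_self, mul_one, map_smul, ← monomialBasis_apply h2 hv, Module.Basis.repr_self]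
    simp
  rw [derivCoeff, ← hφ, hsum, φ.map_finsum hfin, finsum_congr hterm,
    finsum_eq_single _ S fun T hT => Finsupp.single_eq_of_ne' hT, Finsupp.single_eq_same]

open Classical in
/-- The coefficient `α_S` of a derivation: half the coefficient of `v_S` in `D (v i) * v i` for
any `i` such that `v_S` and `v i` anticommute. When there is no such `i`, that is for `S = ∅`, the
derivation `ad v_S` is zero and the value `0` is chosen. -/
noncomputable def adCoeff (h2 : (2 : F) ≠ 0) (hv : IsOrthonormalBasis Q v)
    (D : CliffordAlgebra Q →ₗ[F] CliffordAlgebra Q) (S : Finset ℕ) : F :=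
  if h : ∃ i, commSign F i S = -1 then derivCoeff h2 hv D h.choose S / 2 else 0

lemma adCoeff_eq (h2 : (2 : F) ≠ 0) (hv : IsOrthonormalBasis Q v) (hD : IsDerivation D)
    {i : ℕ} {S : Finset ℕ} (hi : commSign F i S = -1) :
    adCoeff h2 hv D S = derivCoeff h2 hv D i S / 2 := by
  have h : ∃ i, commSign F i S = -1 := ⟨i, hi⟩
  rw [adCoeff, dif_pos h, derivCoeff_eq h2 hv hD h.choose_spec hi]

lemma exists_of_adCoeff_ne_zero (h2 : (2 : F) ≠ 0) (hv : IsOrthonormalBasis Q v)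
    {S : Finset ℕ} (hS : adCoeff h2 hv D S ≠ 0) :
    ∃ i, commSign F i S = -1 ∧ derivCoeff h2 hv D i S ≠ 0 := by
  rw [adCoeff] at hS
  split_ifs at hS with h
  · exact ⟨h.choose, h.choose_spec, fun h0 => hS (by rw [h0, zero_div])⟩
  · exact absurd rfl hS

lemma finite_adCoeff_ne_zero (h2 : (2 : F) ≠ 0) (hv : IsOrthonormalBasis Q v)
    (hD : IsDerivation D) (i : ℕ) :
    {S : Finset ℕ | adCoeff h2 hv D S ≠ 0 ∧ commSign F i S = -1}.Finite := by
  refine (derivCoeff h2 hv D i).support.finite_toSet.subset fun S hS => ?_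
  rw [Finset.mem_coe, Finsupp.mem_support_iff]
  intro h0
  exact hS.1 (by rw [adCoeff_eq h2 hv hD hS.2, h0, zero_div])

lemma adCoeff_smul_ad_ι (h2 : (2 : F) ≠ 0) (hv : IsOrthonormalBasis Q v) (hD : IsDerivation D)
    (i : ℕ) (S : Finset ℕ) :
    (adCoeff h2 hv D S • ad F (basisProd Q v S)) (CliffordAlgebra.ι Q (v i)) =
      (derivCoeff h2 hv D i S • basisProd Q v S) * CliffordAlgebra.ι Q (v i) := by
  rw [LinearMap.smul_apply, ad_basisProd_ι hv, smul_smul, smul_mul_assoc]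
  congr 1
  by_cases hi : commSign F i S = -1
  · rw [adCoeff_eq h2 hv hD hi, hi]
    field_simp
    ring
  · rw [derivCoeff_eq_zero h2 hv hD hi, (commSign_eq_one_or F i S).resolve_right hi, sub_self,
      mul_zero]

/-- Every derivation is the pointwise convergent sum of the inner derivations
`adCoeff h2 hv D S • ad v_S`. -/
lemma isPointwiseSum_adCoeff (h2 : (2 : F) ≠ 0) (hv : IsOrthonormalBasis Q v)
    (hD : IsDerivation D) :
    IsPointwiseSum (fun S => adCoeff h2 hv D S • ad F (basisProd Q v S)) D := by
  refine isPointwiseSum_of_basis v (fun S => (isDerivation_ad _).smul _) hD fun i => ?_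
  have hfin : {S | derivCoeff h2 hv D i S • basisProd Q v S ≠ 0} ⊆
      (derivCoeff h2 hv D i).support := fun S hS => by
    rw [Finset.mem_coe, Finsupp.mem_support_iff]
    exact fun h0 => hS (by rw [h0, zero_smul])
  have hfin' := (derivCoeff h2 hv D i).support.finite_toSet.subset hfin
  have hsum := (monomialBasis h2 hv).linearCombination_repr
    (D (CliffordAlgebra.ι Q (v i)) * CliffordAlgebra.ι Q (v i))
  rw [← derivCoeff, Finsupp.linearCombination_apply, Finsupp.sum] at hsum
  simp only [monomialBasis_apply] at hsum
  simp only [adCoeff_smul_ad_ι h2 hv hD]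
  refine ⟨hfin'.subset fun S hS h0 => hS (by rw [h0, zero_mul]), ?_⟩
  rw [← finsum_mul' _ _ hfin', finsum_eq_sum_of_support_subset _ hfin, hsum, mul_assoc,
    hv.ι_mul_self, mul_one]

lemma eq_adCoeff (h2 : (2 : F) ≠ 0) (hv : IsOrthonormalBasis Q v) (hD : IsDerivation D)
    {α : Finset ℕ → F} (h : IsPointwiseSum (fun S => α S • ad F (basisProd Q v S)) D)
    {i : ℕ} {S : Finset ℕ} (hi : commSign F i S = -1) : α S = adCoeff h2 hv D S := by
  rw [adCoeff_eq h2 hv hD hi, derivCoeff_of_isPointwiseSum h2 hv h, hi]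
  field_simp
  ring

lemma IsEvenMap.even_card (h2 : (2 : F) ≠ 0) (hv : IsOrthonormalBasis Q v)
    (hD : IsEvenMap Q D) {S : Finset ℕ} (hS : adCoeff h2 hv D S ≠ 0) : Even S.card := by
  obtain ⟨i, -, hi⟩ := exists_of_adCoeff_ne_zero h2 hv hS
  have hv1 := CliffordAlgebra.ι_mem_evenOdd_one Q (v i)
  exact even_card_of_repr_ne_zero h2 hv
    (CliffordAlgebra.evenOdd_mul_le Q 1 1 (Submodule.mul_mem_mul (hD.2 _ hv1) hv1)) hi

lemma IsOddMap.odd_card (h2 : (2 : F) ≠ 0) (hv : IsOrthonormalBasis Q v)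
    (hD : IsOddMap Q D) {S : Finset ℕ} (hS : adCoeff h2 hv D S ≠ 0) : Odd S.card := by
  obtain ⟨i, -, hi⟩ := exists_of_adCoeff_ne_zero h2 hv hS
  have hv1 := CliffordAlgebra.ι_mem_evenOdd_one Q (v i)
  exact odd_card_of_repr_ne_zero h2 hv
    (CliffordAlgebra.evenOdd_mul_le Q 0 1 (Submodule.mul_mem_mul (hD.2 _ hv1) hv1)) hi

end Derivations

end CliffordDer

theorem theorem2 {F V : Type*} [Field F] [IsAlgClosed F] (h2 : (2 : F) ≠ 0)
    [AddCommGroup V] [Module F V] (Q : QuadraticForm F V)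
    (v : Module.Basis ℕ F V) (hv : CliffordDer.IsOrthonormalBasis Q v) :
    (∀ D : CliffordAlgebra Q →ₗ[F] CliffordAlgebra Q,
      CliffordDer.IsDerivation D → CliffordDer.IsEvenMap Q D → D ≠ 0 →
      ∃! α : Finset ℕ → F,
        (∀ S, α S ≠ 0 → S.Nonempty ∧ Even S.card) ∧
        (∀ i, {S : Finset ℕ | α S ≠ 0 ∧ i ∈ S}.Finite) ∧
        CliffordDer.IsPointwiseSum
          (fun S => α S • CliffordDer.ad F (CliffordDer.basisProd Q v S)) D) ∧
    (∀ D : CliffordAlgebra Q →ₗ[F] CliffordAlgebra Q,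
      CliffordDer.IsDerivation D → CliffordDer.IsOddMap Q D → D ≠ 0 →
      ∃! α : Finset ℕ → F,
        (∀ S, α S ≠ 0 → Odd S.card) ∧
        (∀ i, {S : Finset ℕ | α S ≠ 0 ∧ i ∉ S}.Finite) ∧
        CliffordDer.IsPointwiseSum
          (fun S => α S • CliffordDer.ad F (CliffordDer.basisProd Q v S)) D) := by
  -- For `S` even, `v_S` and `v i` anticommute iff `i ∈ S`; for `S` odd, iff `i ∉ S`.
  have hneg := fun i S => CliffordDer.commSign_eq_neg_one_iff h2 i S
  refine ⟨fun D hD hp _ => ?_, fun D hD hp _ => ?_⟩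
  · refine ⟨CliffordDer.adCoeff h2 hv D, ⟨fun S hS => ?_, fun i => ?_,
      CliffordDer.isPointwiseSum_adCoeff h2 hv hD⟩, ?_⟩
    · have heven := hp.even_card h2 hv hS
      obtain ⟨i, hi, -⟩ := CliffordDer.exists_of_adCoeff_ne_zero h2 hv hS
      exact ⟨⟨i, ((hneg i S).1 hi).1 heven⟩, heven⟩
    · refine (CliffordDer.finite_adCoeff_ne_zero h2 hv hD i).subset fun S hS => ?_
      have heven := hp.even_card h2 hv hS.1
      exact ⟨hS.1, (hneg i S).2 (iff_of_true heven hS.2)⟩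
    · rintro β ⟨hβ, -, hsum⟩
      funext S
      by_cases hS : S.Nonempty ∧ Even S.card
      · obtain ⟨⟨i, hi⟩, heven⟩ := hS
        exact CliffordDer.eq_adCoeff h2 hv hD hsum ((hneg i S).2 (iff_of_true heven hi))
      · rw [not_not.1 fun h => hS (hβ S h)]
        by_contra h0
        have h := Ne.symm h0
        refine hS ?_
        have heven := hp.even_card h2 hv h
        obtain ⟨i, hi, -⟩ := CliffordDer.exists_of_adCoeff_ne_zero h2 hv h
        exact ⟨⟨i, ((hneg i S).1 hi).1 heven⟩, heven⟩
  · refine ⟨CliffordDer.adCoeff h2 hv D, ⟨fun S hS => hp.odd_card h2 hv hS, fun i => ?_,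
      CliffordDer.isPointwiseSum_adCoeff h2 hv hD⟩, ?_⟩
    · refine (CliffordDer.finite_adCoeff_ne_zero h2 hv hD i).subset fun S hS => ?_
      have hodd := Nat.not_even_iff_odd.2 (hp.odd_card h2 hv hS.1)
      exact ⟨hS.1, (hneg i S).2 (iff_of_false hodd hS.2)⟩
    · rintro β ⟨hβ, -, hsum⟩
      funext S
      by_cases hS : Odd S.card
      · obtain ⟨i, hi⟩ := Infinite.exists_notMem_finset S
        exact CliffordDer.eq_adCoeff h2 hv hD hsum
          ((hneg i S).2 (iff_of_false (Nat.not_even_iff_odd.2 hS) hi))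
      · rw [not_not.1 fun h => hS (hβ S h), not_not.1 fun h => hS (hp.odd_card h2 hv h)]
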